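/- **Setting.** Let $d\ge 1$, $N\in\mathbb{N}$, $0\le\eta<\tfrac12$, $\gamma=\tfrac12-\eta$, $0<\delta<1$, $r>0$, and let $w\in\mathbb{R}^d\setminus\{0\}$. The target separator is the hyperplane $\{y: w\cdot y=0\}$; the correct label of a location $x\in\mathbb{R}^d$ is positive if $w\cdot x>0$ and negative otherwise. There are $N$ sensors, whose locations are independent and uniformly distributed in the unit ball of $\mathbb{R}^d$. Given the locations, the initial states (positive or negative) of the sensors are independent, and each sensor's initial state is its correct label with probability at least $1-\eta$ (these probabilities may differ between sensors and may depend on the locations). The neighbors of a sensor are the other sensors within distance $r$ of it, and its payoff is the fraction of its neighbors in the same state as it minus the fraction in the opposite state ($0$ if it has no neighbors). In random order best-response dynamics the sensors move one at a time, once each, in a uniformly random order that is independent of the locations and the initial states; a sensor that moves takes a state that maximizes its payoff given the current states of its neighbors, that is, the majority state of its neighbors. Ties may be broken arbitrarily. A sensor updates correctly if the state it takes when it moves is its correct label. **Theorem.** There are absolute constants $c_3,c_4>0$ such that in this setting, for all $d,N,\eta,\delta,r,w$ as above, if $$r\le\frac{\gamma}{c_3\sqrt d}\qquad\text{and}\qquad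 N\ge\frac{c_4}{(r/2)^d\gamma^2}\,\ln\!\left(\frac{1}{r^d\gamma\delta}\right),$$ then with probability at least $1-\delta$, every sensor at distance greater than $2r$ from the target separator updates correctly, however ties are broken. -/

import Mathlib

open MeasureTheory ProbabilityTheory

noncomputable section

namespace SensorGame

/-- Euclidean space `ℝ^d`. -/
abbrev E (d : ℕ) : Type := EuclideanSpace ℝ (Fin d)

/-- The linear separator (hyperplane through the origin) with normal vector `w`. -/
def separator {d : ℕ} (w : E d) : Set (E d) := {y | inner ℝ w y = 0}

open Classical in
/-- The correct label of a location: `true` (positive) on the positive side of the separator with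
normal vector `w`, and `false` (negative) otherwise. -/
def target {d : ℕ} (w x : E d) : Bool := decide (0 < inner ℝ w x)

open Classical in
/-- The neighbours of sensor `i`: the other sensors within distance `r` of it. -/
def neighbors {d N : ℕ} (x : Fin N → E d) (r : ℝ) (i : Fin N) : Finset (Fin N) :=
  Finset.univ.filter fun j => j ≠ i ∧ dist (x i) (x j) ≤ r

/-- The payoff of sensor `i` when it is in state `b` and the others are in the states `s`: the
fraction of its neighbours in state `b` minus the fraction in the opposite state
(and `0` if it has no neighbours). -/
def payoff {d N : ℕ} (x : Fin N → E d) (r : ℝ) (s : Fin N → Bool) (i : Fin N) (b : Bool) : ℝ :=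
  ((((neighbors x r i).filter fun j => s j = b).card : ℝ)
    - (((neighbors x r i).filter fun j => s j ≠ b).card : ℝ)) / ((neighbors x r i).card : ℝ)

/-- State `b` is a best response of sensor `i` to the states `s`. In the case of a tie, both states
are best responses. -/
def IsBestResponse {d N : ℕ} (x : Fin N → E d) (r : ℝ) (s : Fin N → Bool) (i : Fin N)
    (b : Bool) : Prop :=
  ∀ b' : Bool, payoff x r s i b' ≤ payoff x r s i b

/-- `st 0, st 1, …, st N` is a run of the best-response dynamics from the initial state `s₀`, in
which the sensors move one at a time, once each, in the order `σ 0, σ 1, …, σ (N - 1)`: the move at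
time `t` puts sensor `σ t` in a best response to the current states. -/
def IsRun {d N : ℕ} (x : Fin N → E d) (r : ℝ) (s₀ : Fin N → Bool) (σ : Equiv.Perm (Fin N))
    (st : ℕ → Fin N → Bool) : Prop :=
  st 0 = s₀ ∧ ∀ t : Fin N, ∃ b : Bool,
    IsBestResponse x r (st t) (σ t) b ∧ st (t + 1) = Function.update (st t) (σ t) b

/-- In every run of the best-response dynamics, however ties are broken, every sensor at distance
greater than `2 r` from the separator takes its correct label when it moves. -/
def FarSensorsUpdateCorrectly {d N : ℕ} (w : E d) (r : ℝ) (x : Fin N → E d) (s₀ : Fin N → Bool)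
    (σ : Equiv.Perm (Fin N)) : Prop :=
  ∀ st : ℕ → Fin N → Bool, IsRun x r s₀ σ st →
    ∀ t : Fin N, 2 * r < Metric.infDist (x (σ t)) (separator w) →
      st (t + 1) (σ t) = target w (x (σ t))

/-- The uniform distribution on the unit ball of `ℝ^d`. -/
def uniformBall (d : ℕ) : Measure (E d) :=
  cond (volume : Measure (E d)) (Metric.closedBall 0 1)

/-- The law of `N` independent, uniformly distributed sensor locations. -/
def locationLaw (d N : ℕ) : Measure (Fin N → E d) := Measure.pi fun _ => uniformBall d

/-- `κ`, the conditional law of the initial states given the locations, has noise rate at most `η`: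
given the locations, the initial states are independent, and each of them is correct with
probability at least `1 - η`. The probabilities may vary with the sensor and the locations. -/
def HasNoiseRate {d N : ℕ} (w : E d) (η : ℝ) (κ : Kernel (Fin N → E d) (Fin N → Bool)) : Prop :=
  ∀ᵐ x ∂(locationLaw d N),
    iIndepFun (fun (i : Fin N) (s : Fin N → Bool) => s i) (κ x) ∧
    ∀ i : Fin N, ENNReal.ofReal (1 - η) ≤ κ x {s | s i = target w (x i)}

instance permMeasurableSpace (N : ℕ) : MeasurableSpace (Equiv.Perm (Fin N)) := ⊤

/-- The uniform distribution on the orders of the `N` sensors. -/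
def orderLaw (N : ℕ) : Measure (Equiv.Perm (Fin N)) :=
  (PMF.uniformOfFintype (Equiv.Perm (Fin N))).toMeasure

/-- The joint law of the locations, the initial states and the order of moves; the order is
independent of the locations and the initial states. -/
def law {d N : ℕ} (κ : Kernel (Fin N → E d) (Fin N → Bool)) :
    Measure (((Fin N → E d) × (Fin N → Bool)) × Equiv.Perm (Fin N)) :=
  ((locationLaw d N).compProd κ).prod (orderLaw N)

end SensorGame

end

noncomputable section

namespace SensorGame

/-! Replace the dynamics by a condition on the initial data. Whether a neighbour is good depends
only on locations, initial states and the order, never on the run, so the adaptive dependence and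
the tie-breaking disappear: if no move is bad, every run behaves well
(`farSensorsUpdateCorrectly_of_not_badMove`). During the first three quarters of the moves, sensors
at distance more than `r` from the separator are correct by induction on time; in the last quarter,
a sensor at distance more than `2r` has all its neighbours at distance more than `r`, and about
three quarters of them have moved correctly.

The early phase needs good neighbours to be a majority. A neighbour that has not moved is correct
with probability at least `1/2 + γ`. One that has moved counts only if it is at distance more than
`r`, which by `half_volume_of_inner_le` has conditional probability at least `1/2 - γ/64`. At least
about a quarter have not moved, so the gain beats the loss.

A bad move is then excluded by a Chernoff bound on `exp (lam * (B - G))` with `lam = γ/16`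
(`lintegral_moveWeight_le`), averaging over initial states, then over the other locations, then over
the mover's location. The bound holds for each fixed order. A union bound over the `N` positions
finishes the proof. -/

/-! ### Geometry of the separator and volumes in ball intersections -/

lemma infDist_separator {d : ℕ} {w : E d} (hw : w ≠ 0) (x : E d) :
    Metric.infDist x (separator w) = |inner ℝ w x| / ‖w‖ := by
  have hw' : 0 < ‖w‖ := norm_pos_iff.2 hw
  have hne : (separator w).Nonempty := ⟨0, by simp [separator]⟩
  apply le_antisymm
  · have hmem : x - (inner ℝ w x / ‖w‖ ^ 2) • w ∈ separator w := by
      simp only [separator, Set.mem_ofPred_eq, inner_sub_right, inner_smul_right,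
        real_inner_self_eq_norm_sq]
      field_simp
      ring
    refine (Metric.infDist_le_dist_of_mem hmem).trans (le_of_eq ?_)
    rw [dist_eq_norm, sub_sub_cancel, norm_smul, Real.norm_eq_abs, abs_div,
      abs_of_nonneg (sq_nonneg ‖w‖)]
    field_simp
  · rw [Metric.le_infDist hne]
    intro y hy
    rw [div_le_iff₀ hw', dist_eq_norm, mul_comm]
    have : inner ℝ w x = inner ℝ w (x - y) := by
      rw [inner_sub_right, show inner ℝ w y = 0 from hy, sub_zero]
    rw [this]
    exact abs_real_inner_le_norm _ _

lemma separator_neg {d : ℕ} (w : E d) : separator (-w) = separator w := by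
  ext y; simp [separator, inner_neg_left]

lemma continuous_infDist_separator {d : ℕ} (w : E d) :
    Continuous fun y => Metric.infDist y (separator w) := Metric.continuous_infDist_pt _

/-- A ball contained in the intersection of the unit ball with a ball around one of its points. -/
lemma closedBall_half_subset {d : ℕ} {x : E d} {r : ℝ} (hx : ‖x‖ ≤ 1) (hr : 0 < r) (hr1 : r ≤ 1) :
    Metric.closedBall ((1 - r / 2) • x) (r / 2) ⊆ Metric.closedBall x r ∩ Metric.closedBall 0 1 := by
  intro y hy
  have h1 : ‖(1 - r / 2) • x - x‖ ≤ r / 2 := by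
    rw [show (1 - r / 2) • x - x = -(r / 2) • x by module, norm_smul, Real.norm_eq_abs, abs_neg,
      abs_of_pos (by positivity)]
    nlinarith
  have h2 : ‖(1 - r / 2) • x‖ ≤ 1 - r / 2 := by
    rw [norm_smul, Real.norm_eq_abs, abs_of_nonneg (by linarith)]
    nlinarith
  rw [Metric.mem_closedBall, dist_eq_norm] at hy
  constructor
  · rw [Metric.mem_closedBall, dist_eq_norm]
    calc ‖y - x‖ = ‖(y - (1 - r / 2) • x) + ((1 - r / 2) • x - x)‖ := by congr 1; abel
      _ ≤ _ := norm_add_le _ _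
      _ ≤ r := by linarith
  · rw [Metric.mem_closedBall, dist_eq_norm, sub_zero]
    calc ‖y‖ = ‖(y - (1 - r / 2) • x) + ((1 - r / 2) • x)‖ := by congr 1; abel
      _ ≤ _ := norm_add_le _ _
      _ ≤ 1 := by linarith

/-- The `k`-th of the maps that carry a thin slab to disjoint translates. -/
def slabShift {d : ℕ} (x n : E d) (r h β : ℝ) (k : ℕ) (y : E d) : E d :=
  (β • ((1 - r / 2) • x) + (k * h / ‖n‖ ^ 2) • n) + (1 - β) • y

lemma inner_slabShift {d : ℕ} {x n : E d} (r h β : ℝ) (k : ℕ) (y : E d) (hn : n ≠ 0)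
    (hnx : inner ℝ n x = 0) :
    inner ℝ n (slabShift x n r h β k y) = (1 - β) * inner ℝ n y + k * h := by
  have : ‖n‖ ≠ 0 := norm_ne_zero_iff.2 hn
  simp only [slabShift, inner_add_right, inner_smul_right, hnx, real_inner_self_eq_norm_sq]
  field_simp
  ring

/-- The shift is nearly orthogonal to `z` on its outward side, so it costs only second order in the
norm: `2k + k² ≤ (k + 1)² ≤ K²`. This is why `√d`, and not `d`, appears in the condition on `r`. -/
lemma norm_add_smul_sq_le {d : ℕ} {z n : E d} {h : ℝ} {k K : ℕ} (hn : n ≠ 0) (h0 : 0 < h)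
    (hz0 : inner ℝ n z ≤ h) (hk : k < K) :
    ‖z + (k * h / ‖n‖ ^ 2) • n‖ ^ 2 ≤ ‖z‖ ^ 2 + (K * h / ‖n‖) ^ 2 := by
  have hn' : 0 < ‖n‖ := norm_pos_iff.2 hn
  rw [norm_add_sq_real, inner_smul_right, norm_smul, Real.norm_eq_abs, mul_pow, sq_abs,
    real_inner_comm]
  have hk' : (k : ℝ) + 1 ≤ K := by exact_mod_cast hk
  have hk0 : (0 : ℝ) ≤ k := by positivity
  have e1 : (k * h / ‖n‖ ^ 2) * inner ℝ n z ≤ (k * h / ‖n‖ ^ 2) * h := by gcongr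
  have e2 : 2 * ((k * h / ‖n‖ ^ 2) * h) + (k * h / ‖n‖ ^ 2) ^ 2 * ‖n‖ ^ 2
      = (2 * k + k ^ 2) * (h / ‖n‖) ^ 2 := by field_simp
  have e3 : (K * h / ‖n‖) ^ 2 = K ^ 2 * (h / ‖n‖) ^ 2 := by ring
  have e4 : (2 * k + k ^ 2 : ℝ) * (h / ‖n‖) ^ 2 ≤ K ^ 2 * (h / ‖n‖) ^ 2 := by
    apply mul_le_mul_of_nonneg_right _ (sq_nonneg _)
    nlinarith
  linarith

/-- Contracting by `1 - β` towards `(1 - r/2) • x` leaves a margin `β r / 2` inside both balls,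
hence room of order `β r²` in the squared norm for the shift along `n`. Both centres, `x` and `0`,
lie on the hyperplane orthogonal to `n`, so one argument serves both balls. -/
lemma slabShift_mem {d : ℕ} {x n : E d} {r h β : ℝ} {k K : ℕ} {y : E d}
    (hx : ‖x‖ ≤ 1) (hr : 0 < r) (hr1 : r ≤ 1) (hn : n ≠ 0) (hnx : inner ℝ n x = 0)
    (h0 : 0 < h) (hβ : 0 ≤ β) (hβ1 : β ≤ 1) (hk : k < K) (hK : 4 * (K * h / ‖n‖) ^ 2 ≤ 2 * β * r ^ 2)
    (hy : y ∈ Metric.closedBall x r ∩ Metric.closedBall 0 1) (hyn0 : 0 ≤ inner ℝ n y)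
    (hyn : inner ℝ n y < h) :
    slabShift x n r h β k y ∈ Metric.closedBall x r ∩ Metric.closedBall 0 1 := by
  obtain ⟨hy1, hy2⟩ := hy
  rw [Metric.mem_closedBall, dist_eq_norm] at hy1 hy2
  rw [sub_zero] at hy2
  have hc1 : ‖(1 - r / 2) • x - x‖ ≤ r / 2 := by
    rw [show (1 - r / 2) • x - x = -(r / 2) • x by module, norm_smul, Real.norm_eq_abs, abs_neg,
      abs_of_pos (by positivity)]
    nlinarith
  have hc2 : ‖(1 - r / 2) • x‖ ≤ 1 - r / 2 := by
    rw [norm_smul, Real.norm_eq_abs, abs_of_nonneg (by linarith)]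
    nlinarith
  have key : ∀ a : E d, inner ℝ n a = 0 → ∀ R : ℝ, 0 ≤ R → r ≤ R → ‖y - a‖ ≤ R →
      ‖(1 - r / 2) • x - a‖ ≤ R - r / 2 → ‖slabShift x n r h β k y - a‖ ≤ R := by
    intro a ha R hR hrR h1 h2
    set z := (1 - β) • (y - a) + β • ((1 - r / 2) • x - a) with hz
    have e : slabShift x n r h β k y - a = z + (k * h / ‖n‖ ^ 2) • n := by
      rw [hz, slabShift]; module
    have hzn : ‖z‖ ≤ R - β * r / 2 := by
      calc ‖z‖ ≤ ‖(1 - β) • (y - a)‖ + ‖β • ((1 - r / 2) • x - a)‖ := norm_add_le _ _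
        _ = (1 - β) * ‖y - a‖ + β * ‖(1 - r / 2) • x - a‖ := by
          rw [norm_smul, norm_smul, Real.norm_eq_abs, Real.norm_eq_abs, abs_of_nonneg hβ,
            abs_of_nonneg (by linarith)]
        _ ≤ (1 - β) * R + β * (R - r / 2) := by
          have := mul_le_mul_of_nonneg_left h1 (by linarith : 0 ≤ 1 - β)
          have := mul_le_mul_of_nonneg_left h2 hβ
          linarith
        _ = _ := by ring
    have hzi : inner ℝ n z ≤ h := by
      simp only [hz, inner_add_right, inner_sub_right, inner_smul_right, hnx, ha]
      nlinarith
    have hsq := norm_add_smul_sq_le (K := K) hn h0 hzi hk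
    rw [e]
    apply le_of_sq_le_sq _ hR
    have h3 : ‖z‖ ^ 2 ≤ (R - β * r / 2) ^ 2 := by
      gcongr
    have h4 : β * r ^ 2 ≤ β * r * R := by nlinarith [mul_nonneg hβ hr.le]
    have h5 : (β * r / 2) ^ 2 ≤ β * r * R / 4 := by nlinarith [mul_nonneg hβ hr.le]
    nlinarith
  constructor
  · rw [Metric.mem_closedBall, dist_eq_norm]
    exact key x hnx r hr.le le_rfl hy1 (by linarith)
  · rw [Metric.mem_closedBall, dist_eq_norm]
    exact key 0 (by simp) 1 zero_le_one hr1 (by simpa using hy2) (by simpa using hc2)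

open scoped Pointwise in
/-- A thin slab around a hyperplane through the origin and `x` carries a small part of the volume
of the intersection of the unit ball with a ball around `x`. -/
lemma volume_slab_le {d : ℕ} (hd : 1 ≤ d) {x n : E d} {r h : ℝ} {K : ℕ}
    (hx : ‖x‖ ≤ 1) (hr : 0 < r) (hr1 : r ≤ 1) (hn : n ≠ 0) (hnx : inner ℝ n x = 0)
    (h0 : 0 < h) (hK : 4 * (K * h / ‖n‖) ^ 2 * d ≤ r ^ 2) :
    K * volume.real ((Metric.closedBall x r ∩ Metric.closedBall 0 1) ∩
        {y | 0 ≤ inner ℝ n y ∧ inner ℝ n y < h}) ≤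
      2 * volume.real (Metric.closedBall x r ∩ Metric.closedBall (0 : E d) 1) := by
  set A : Set (E d) := Metric.closedBall x r ∩ Metric.closedBall 0 1 with hA
  set S : Set (E d) := A ∩ {y | 0 ≤ inner ℝ n y ∧ inner ℝ n y < h} with hS
  have hd' : (1 : ℝ) ≤ d := by exact_mod_cast hd
  -- Small enough that the contraction keeps half of the volume (Bernoulli, with `d * β = 1/2`),
  -- large enough to leave room for the shifts.
  set β : ℝ := 1 / (2 * d) with hβ
  have hβ0 : 0 < β := by positivity
  have hβ1 : β ≤ 1 / 2 := by
    rw [hβ, div_le_div_iff₀ (by positivity) (by norm_num)]; linarith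
  have hAm : MeasurableSet A := measurableSet_closedBall.inter measurableSet_closedBall
  have hcont : Continuous fun y : E d => inner ℝ n y := by fun_prop
  have hSm : MeasurableSet S := hAm.inter
    ((hcont.measurable measurableSet_Ici).inter (hcont.measurable measurableSet_Iio))
  have hK' : 4 * (K * h / ‖n‖) ^ 2 ≤ 2 * β * r ^ 2 := by
    have : 2 * β * r ^ 2 = r ^ 2 / d := by rw [hβ]; field_simp
    rw [this, le_div_iff₀ (by positivity)]
    exact hK
  have himg : ∀ k : ℕ, slabShift x n r h β k '' S =
      (β • ((1 - r / 2) • x) + (k * h / ‖n‖ ^ 2) • n) +ᵥ ((1 - β) • S) := by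
    intro k
    rw [← Set.image_vadd, ← Set.image_smul, Set.image_image]
    rfl
  have hβne : 1 - β ≠ 0 := by linarith
  have hmeas : ∀ k : ℕ, MeasurableSet (slabShift x n r h β k '' S) := fun k => by
    rw [himg]
    exact (hSm.const_smul_of_ne_zero hβne).const_vadd _
  have hvol : ∀ k : ℕ, volume (slabShift x n r h β k '' S) =
      ENNReal.ofReal ((1 - β) ^ d) * volume S := fun k => by
    rw [himg, measure_vadd, Measure.addHaar_smul, finrank_euclideanSpace_fin,
      abs_of_nonneg (pow_nonneg (by linarith) _)]
  -- On the `k`-th copy the inner product with `n` lies in `[k h, (k + 1) h)`.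
  have hdisj : (↑(Finset.range K) : Set ℕ).PairwiseDisjoint
      (fun k => slabShift x n r h β k '' S) := by
    intro k _ l _ hkl
    rw [Function.onFun, Set.disjoint_left]
    rintro _ ⟨y, hy, rfl⟩ ⟨y', hy', he⟩
    have e := congrArg (fun v => inner ℝ n v) he
    simp only [inner_slabShift r h β _ _ hn hnx] at e
    obtain ⟨-, hy1, hy2⟩ := hy
    obtain ⟨-, hy1', hy2'⟩ := hy'
    have b1 : (1 - β) * inner ℝ n y < h := by nlinarith
    have b2 : (1 - β) * inner ℝ n y' < h := by nlinarith
    have b3 : 0 ≤ (1 - β) * inner ℝ n y := mul_nonneg (by linarith) hy1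
    have b4 : 0 ≤ (1 - β) * inner ℝ n y' := mul_nonneg (by linarith) hy1'
    rcases lt_or_gt_of_ne hkl with hlt | hlt
    · have : (k : ℝ) + 1 ≤ l := by exact_mod_cast hlt
      nlinarith
    · have : (l : ℝ) + 1 ≤ k := by exact_mod_cast hlt
      nlinarith
  have hsub : (⋃ k ∈ Finset.range K, slabShift x n r h β k '' S) ⊆ A := by
    simp only [Set.iUnion_subset_iff]
    rintro k hk _ ⟨y, ⟨hyA, hy1, hy2⟩, rfl⟩
    exact slabShift_mem hx hr hr1 hn hnx h0 hβ0.le (by linarith) (Finset.mem_range.1 hk) hK' hyA hy1 hy2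
  have hAfin : volume A ≠ ⊤ :=
    ((measure_mono Set.inter_subset_right).trans_lt measure_closedBall_lt_top).ne
  have hfin := measure_mono (μ := volume) hsub
  rw [measure_biUnion_finset hdisj (fun k _ => hmeas k)] at hfin
  simp only [hvol, Finset.sum_const, Finset.card_range, nsmul_eq_mul] at hfin
  have hre := ENNReal.toReal_mono hAfin hfin
  rw [ENNReal.toReal_mul, ENNReal.toReal_mul, ENNReal.toReal_natCast, ENNReal.toReal_ofReal
    (pow_nonneg (by linarith) _)] at hre
  have hbern : 1 / 2 ≤ (1 - β) ^ d := by
    have := one_add_mul_le_pow (a := -β) (by linarith) d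
    have e : (d : ℝ) * β = 1 / 2 := by rw [hβ]; field_simp
    rw [← sub_eq_add_neg] at this
    linarith
  have : (K : ℝ) * (1 / 2 * volume.real S) ≤ K * ((1 - β) ^ d * volume.real S) := by gcongr
  simp only [Measure.real] at *
  linarith

/-- `A` is covered by `A ∩ P` and its preimage under `f`, which have equal measure. It is applied to
reflections. -/
lemma measureReal_le_two_mul_of_subset {α : Type*} [MeasurableSpace α] {μ : Measure α} {A P : Set α}
    {f : α → α} (hf : MeasurePreserving f μ μ) (hA : MeasurableSet A) (hP : MeasurableSet P)
    (hfin : μ A ≠ ⊤) (h : ∀ y ∈ A, y ∉ P → f y ∈ A ∩ P) : μ.real A ≤ 2 * μ.real (A ∩ P) := by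
  have hAP : μ (A ∩ P) ≠ ⊤ := measure_ne_top_of_subset Set.inter_subset_left hfin
  have hpre : μ (f ⁻¹' (A ∩ P)) = μ (A ∩ P) :=
    hf.measure_preimage (hA.inter hP).nullMeasurableSet
  have hsub : A ⊆ (A ∩ P) ∪ f ⁻¹' (A ∩ P) := fun y hy => by
    by_cases hyP : y ∈ P
    · exact Or.inl ⟨hy, hyP⟩
    · exact Or.inr (h y hy hyP)
  have h1 : μ.real A ≤ μ.real ((A ∩ P) ∪ f ⁻¹' (A ∩ P)) :=
    measureReal_mono hsub (measure_union_ne_top hAP (by rwa [hpre]))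
  have h2 := measureReal_union_le (μ := μ) (A ∩ P) (f ⁻¹' (A ∩ P))
  have h3 : μ.real (f ⁻¹' (A ∩ P)) = μ.real (A ∩ P) := by simp only [Measure.real, hpre]
  linarith

lemma volume_ball_inter_ne_top {d : ℕ} (x : E d) (r : ℝ) :
    volume (Metric.closedBall x r ∩ Metric.closedBall (0 : E d) 1) ≠ ⊤ :=
  ((measure_mono Set.inter_subset_right).trans_lt measure_closedBall_lt_top).ne

set_option maxHeartbeats 1000000 in
/-- At a point at distance between `r` and `2r` from the hyperplane `w^⊥`, almost half of the volume
of the intersection of the `r`-ball with the unit ball is at distance more than `r` from it. -/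
lemma half_volume_of_inner_le {d : ℕ} (hd : 1 ≤ d) {w x : E d} {r γ : ℝ} (hw : ‖w‖ = 1)
    (hx : ‖x‖ ≤ 1) (hr : 0 < r) (hrd : 4096 * (r * √d) ≤ γ) (hγ : γ ≤ 1 / 2)
    (h1 : r < inner ℝ w x) (h2 : inner ℝ w x ≤ 2 * r) :
    (1 / 2 - γ / 64) * volume.real (Metric.closedBall x r ∩ Metric.closedBall (0 : E d) 1) ≤
      volume.real ((Metric.closedBall x r ∩ Metric.closedBall 0 1) ∩ {y | r < inner ℝ w y}) := by
  have hd' : (1 : ℝ) ≤ √d := by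
    rw [Real.one_le_sqrt]; exact_mod_cast hd
  have hrr : r ≤ r * √d := by nlinarith
  have hr2 : r ≤ 1 / 8192 := by linarith
  set A : Set (E d) := Metric.closedBall x r ∩ Metric.closedBall 0 1 with hA
  have hAm : MeasurableSet A := measurableSet_closedBall.inter measurableSet_closedBall
  have hAfin : volume A ≠ ⊤ := volume_ball_inter_ne_top x r
  have hA0 : 0 ≤ volume.real A := measureReal_nonneg
  have hγ0 : 0 ≤ γ := le_trans (by positivity) hrd
  have hmem : ∀ y : E d, y ∈ A ↔ ‖y - x‖ ≤ r ∧ ‖y‖ ≤ 1 := fun y => by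
    simp [hA, Metric.mem_closedBall, dist_eq_norm]
  by_cases hx1 : ‖x‖ ≤ 1 - r
  -- The `r`-ball lies inside the unit ball, so point reflection through `x` suffices.
  · have hP : MeasurableSet {y : E d | inner ℝ w x ≤ inner ℝ w y} :=
      (by fun_prop : Continuous fun y : E d => inner ℝ w y).measurable measurableSet_Ici
    have key := measureReal_le_two_mul_of_subset
      (Measure.measurePreserving_sub_left (volume : Measure (E d)) ((2 : ℝ) • x)) hAm hP hAfin (by
        intro y hy hyP
        rw [hmem] at hy
        have e : ‖(2 : ℝ) • x - y - x‖ ≤ r := by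
          rw [show (2 : ℝ) • x - y - x = -(y - x) by module, norm_neg]; exact hy.1
        refine ⟨(hmem _).2 ⟨e, ?_⟩, ?_⟩
        · calc ‖(2 : ℝ) • x - y‖ = ‖((2 : ℝ) • x - y - x) + x‖ := by congr 1; abel
            _ ≤ _ := norm_add_le _ _
            _ ≤ 1 := by linarith
        · simp only [Set.mem_ofPred_eq, not_le] at hyP ⊢
          rw [inner_sub_right, inner_smul_right]
          linarith)
    have hmono : volume.real (A ∩ {y : E d | inner ℝ w x ≤ inner ℝ w y}) ≤
        volume.real (A ∩ {y : E d | r < inner ℝ w y}) :=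
      measureReal_mono (Set.inter_subset_inter_right _ fun y hy => h1.trans_le hy)
        (measure_ne_top_of_subset Set.inter_subset_left hAfin)
    nlinarith
  · push Not at hx1
    have hx0 : 3 / 4 ≤ ‖x‖ := by linarith
    have hx2 : 1 / 2 ≤ ‖x‖ ^ 2 := by nlinarith
    have hxpos : 0 < ‖x‖ := by linarith
    -- Near the boundary, `w` is replaced by its component `n` orthogonal to `x`: reflection in the
    -- hyperplane orthogonal to `n` fixes `0` and `x`, hence preserves both balls.
    set c : ℝ := inner ℝ w x / ‖x‖ ^ 2 with hc
    set n : E d := w - c • x with hn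
    have hcx : c * ‖x‖ ^ 2 = inner ℝ w x := by rw [hc]; field_simp
    have hc0 : 0 ≤ c := div_nonneg (by linarith) (by positivity)
    have hc8 : c ≤ 4 * r := by
      rw [hc, div_le_iff₀ (by positivity)]
      nlinarith [mul_le_mul_of_nonneg_left hx2 hr.le]
    have hnx : inner ℝ n x = 0 := by
      rw [hn, inner_sub_left, inner_smul_left, real_inner_self_eq_norm_sq]
      simp only [conj_trivial]
      linarith
    have hnn : 1 / 2 ≤ ‖n‖ := by
      have : ‖w‖ ≤ ‖n‖ + ‖c • x‖ := by
        calc ‖w‖ = ‖n + c • x‖ := by rw [hn]; congr 1; abel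
          _ ≤ _ := norm_add_le _ _
      rw [norm_smul, Real.norm_eq_abs, abs_of_nonneg hc0, hw] at this
      nlinarith
    have hn0 : n ≠ 0 := norm_pos_iff.1 (by linarith)
    set f := (Submodule.span ℝ {n})ᗮ.reflection with hf
    have hfn : f n = -n := Submodule.reflection_orthogonalComplement_singleton_eq_neg n
    have hfx : f x = x := by
      rw [hf, Submodule.reflection_eq_self_iff, Submodule.mem_orthogonal_singleton_iff_inner_right]
      exact hnx
    have hfi : ∀ y, inner ℝ n (f y) = - inner ℝ n y := fun y => by
      rw [← f.inner_map_map n y, hfn, inner_neg_left, neg_neg]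
    have hcn : Continuous fun y : E d => inner ℝ n y := by fun_prop
    have hP : MeasurableSet {y : E d | 0 ≤ inner ℝ n y} := hcn.measurable measurableSet_Ici
    have key := measureReal_le_two_mul_of_subset f.measurePreserving hAm hP hAfin (by
      intro y hy hyP
      rw [hmem] at hy
      refine ⟨(hmem _).2 ⟨?_, ?_⟩, ?_⟩
      · rw [← hfx, ← map_sub, f.norm_map]; exact hy.1
      · rw [f.norm_map]; exact hy.2
      · simp only [Set.mem_ofPred_eq, not_le] at hyP ⊢
        rw [hfi]; linarith)
    set a := r * √d with ha
    have hapos : 0 < a := by positivity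
    -- The largest number of slabs that the hypothesis of `volume_slab_le` allows, given `h = 4 r²`
    -- and `‖n‖ ≥ 1/2`.
    set K : ℕ := ⌊1 / (16 * a)⌋₊ with hK
    have hKle : (K : ℝ) ≤ 1 / (16 * a) := Nat.floor_le (by positivity)
    have hKa : K * (16 * a) ≤ 1 := by rwa [le_div_iff₀ (by positivity)] at hKle
    have hKa2 : 1 ≤ K * (32 * a) := by
      have h3 : 1 / (16 * a) < K + 1 := Nat.lt_floor_add_one _
      rw [div_lt_iff₀ (by positivity)] at h3
      nlinarith
    have hslab := volume_slab_le (K := K) (h := 4 * r ^ 2) hd hx hr (by linarith) hn0 hnx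
      (by positivity) (by
        have e1 : K * (4 * r ^ 2) / ‖n‖ ≤ K * (8 * r ^ 2) := by
          rw [div_le_iff₀ (by linarith)]
          have : 0 ≤ K * (8 * r ^ 2) := by positivity
          nlinarith
        have e2 : 0 ≤ K * (4 * r ^ 2) / ‖n‖ := by positivity
        have e3 : (K * (8 * r ^ 2)) ^ 2 * d * 4 = (K * (16 * a)) ^ 2 * r ^ 2 := by
          rw [ha]
          have : √(d : ℝ) ^ 2 = d := Real.sq_sqrt (by positivity)
          linear_combination (-256 * K ^ 2 * r ^ 4) * this
        have e4 : (K * (4 * r ^ 2) / ‖n‖) ^ 2 ≤ (K * (8 * r ^ 2)) ^ 2 := by gcongr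
        have e5 : (K * (16 * a)) ^ 2 ≤ 1 := pow_le_one₀ (by positivity) hKa
        have e6 : (K * (4 * r ^ 2) / ‖n‖) ^ 2 * d ≤ (K * (8 * r ^ 2)) ^ 2 * d := by gcongr
        have e7 : (K * (16 * a)) ^ 2 * r ^ 2 ≤ 1 * r ^ 2 := by gcongr
        linarith)
    -- Since `c ≤ 4 r`, passing from `n` to `w` loses at most `4 r²` on the `r`-ball; this is the
    -- slab's width.
    have hsub : A ∩ {y : E d | 0 ≤ inner ℝ n y} ⊆
        (A ∩ {y | 0 ≤ inner ℝ n y ∧ inner ℝ n y < 4 * r ^ 2}) ∪ (A ∩ {y | r < inner ℝ w y}) := by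
      rintro y ⟨hyA, hy0⟩
      by_cases hyh : inner ℝ n y < 4 * r ^ 2
      · exact Or.inl ⟨hyA, hy0, hyh⟩
      · refine Or.inr ⟨hyA, ?_⟩
        push Not at hyh
        have hxy : -(‖x‖ * ‖y - x‖) ≤ inner ℝ x (y - x) := neg_le_of_abs_le (abs_real_inner_le_norm _ _)
        have hyx := ((hmem y).1 hyA).1
        have e : inner ℝ w y = inner ℝ w x + inner ℝ n y + c * inner ℝ x (y - x) := by
          have : inner ℝ n y = inner ℝ n (y - x) := by rw [inner_sub_right, hnx, sub_zero]
          rw [this, hn, inner_sub_left, inner_smul_left, inner_sub_right w]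
          simp only [conj_trivial]
          ring
        have e2 : ‖x‖ * ‖y - x‖ ≤ r := by nlinarith [norm_nonneg (y - x)]
        have e3 : c * (‖x‖ * ‖y - x‖) ≤ 4 * r * r := by
          apply mul_le_mul hc8 e2 (by positivity) (by positivity)
        have e4 := mul_le_mul_of_nonneg_left hxy hc0
        simp only [Set.mem_ofPred_eq]
        rw [e]
        nlinarith
    have hfin' : ∀ Q : Set (E d), volume (A ∩ Q) ≠ ⊤ := fun Q =>
      measure_ne_top_of_subset Set.inter_subset_left hAfin
    have hu := (measureReal_mono hsub (measure_union_ne_top (hfin' _) (hfin' _))).trans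
      (measureReal_union_le _ _)
    set s := volume.real (A ∩ {y : E d | 0 ≤ inner ℝ n y ∧ inner ℝ n y < 4 * r ^ 2}) with hs
    have hs0 : 0 ≤ s := measureReal_nonneg
    -- The slab has at most a fraction `2 / K ≤ 64 a` of the volume; `64 a ≤ γ / 64` is where the
    -- constant 4096 comes from.
    have hs1 : s ≤ 64 * a * volume.real A := by
      have e1 : s * 1 ≤ s * (K * (32 * a)) := by gcongr
      have e2 := mul_le_mul_of_nonneg_left hslab (by positivity : 0 ≤ 32 * a)
      linarith
    have hs2 : 64 * a * volume.real A ≤ γ / 64 * volume.real A := by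
      gcongr
      linarith
    linarith

/-! ### The uniform distribution on the unit ball -/

lemma volume_unitBall_pos (d : ℕ) : 0 < volume.real (Metric.closedBall (0 : E d) 1) :=
  ENNReal.toReal_pos (Metric.measure_closedBall_pos _ _ one_pos).ne' measure_closedBall_lt_top.ne

instance isProbabilityMeasure_uniformBall (d : ℕ) : IsProbabilityMeasure (uniformBall d) :=
  cond_isProbabilityMeasure_of_finite (Metric.measure_closedBall_pos _ _ one_pos).ne'
    measure_closedBall_lt_top.ne

lemma uniformBall_real_apply {d : ℕ} (S : Set (E d)) :
    (uniformBall d).real S =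
      (volume.real (Metric.closedBall (0 : E d) 1))⁻¹ *
        volume.real (S ∩ Metric.closedBall (0 : E d) 1) := by
  simp only [Measure.real, uniformBall, cond_apply measurableSet_closedBall, ENNReal.toReal_mul,
    ENNReal.toReal_inv, Set.inter_comm S]

lemma ae_uniformBall_norm_le (d : ℕ) : ∀ᵐ x ∂(uniformBall d), ‖x‖ ≤ 1 := by
  filter_upwards [ae_cond_mem (μ := volume) (measurableSet_closedBall (x := (0 : E d)) (ε := 1))]
    with x hx
  simpa using hx

lemma pow_le_uniformBall {d : ℕ} {x : E d} {r : ℝ} (hx : ‖x‖ ≤ 1) (hr : 0 < r) (hr1 : r ≤ 1) :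
    (r / 2) ^ d ≤ (uniformBall d).real (Metric.closedBall x r) := by
  rw [uniformBall_real_apply, inv_mul_eq_div, le_div_iff₀ (volume_unitBall_pos d)]
  have h := measureReal_mono (μ := volume) (closedBall_half_subset hx hr hr1)
    (volume_ball_inter_ne_top x r)
  refine le_trans (le_of_eq ?_) h
  rw [Measure.real, Measure.real, Measure.addHaar_closedBall' _ ((1 - r / 2) • x) (by positivity),
    finrank_euclideanSpace_fin, ENNReal.toReal_mul, ENNReal.toReal_ofReal (by positivity)]

lemma half_uniformBall_le {d : ℕ} (hd : 1 ≤ d) {w x : E d} {r γ : ℝ} (hw : w ≠ 0)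
    (hx : ‖x‖ ≤ 1) (hr : 0 < r) (hrd : 4096 * (r * √d) ≤ γ) (hγ : γ ≤ 1 / 2)
    (h1 : r < Metric.infDist x (separator w)) :
    (1 / 2 - γ / 64) * (uniformBall d).real (Metric.closedBall x r) ≤
      (uniformBall d).real
        (Metric.closedBall x r ∩ {y | r < Metric.infDist y (separator w)}) := by
  have hγ0 : 0 ≤ γ := le_trans (by positivity) hrd
  by_cases h2 : 2 * r < Metric.infDist x (separator w)
  · have : Metric.closedBall x r ∩ {y | r < Metric.infDist y (separator w)} =
        Metric.closedBall x r := by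
      refine Set.inter_eq_left.2 fun y hy => ?_
      have := Metric.infDist_le_infDist_add_dist (s := separator w) (x := x) (y := y)
      rw [Metric.mem_closedBall, dist_comm] at hy
      simp only [Set.mem_ofPred_eq]
      linarith
    rw [this]
    have : 0 ≤ (uniformBall d).real (Metric.closedBall x r) := measureReal_nonneg
    nlinarith
  · push Not at h2
    wlog hpos : 0 ≤ inner ℝ w x generalizing w
    · have := this (w := -w) (neg_ne_zero.2 hw) (by rwa [separator_neg]) (by rwa [separator_neg])
        (by rw [inner_neg_left]; linarith)
      rwa [separator_neg] at this
    have hw' : 0 < ‖w‖ := norm_pos_iff.2 hw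
    have hin : ∀ y : E d, inner ℝ (‖w‖⁻¹ • w) y = inner ℝ w y / ‖w‖ := fun y => by
      rw [inner_smul_left, conj_trivial]; field_simp
    have hx' : Metric.infDist x (separator w) = inner ℝ (‖w‖⁻¹ • w) x := by
      rw [infDist_separator hw, hin, abs_of_nonneg hpos]
    have hle : ∀ y, inner ℝ (‖w‖⁻¹ • w) y ≤ Metric.infDist y (separator w) := fun y => by
      rw [infDist_separator hw, hin]
      gcongr
      exact le_abs_self _
    have key := half_volume_of_inner_le hd (w := ‖w‖⁻¹ • w) (norm_smul_inv_norm hw) hx hr hrd hγ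
      (by rwa [← hx']) (by rwa [← hx'])
    rw [uniformBall_real_apply, uniformBall_real_apply, mul_left_comm]
    refine mul_le_mul_of_nonneg_left (key.trans ?_) (inv_nonneg.2 (volume_unitBall_pos d).le)
    rw [Set.inter_right_comm]
    refine measureReal_mono (Set.inter_subset_inter_left _ (Set.inter_subset_inter_right _
      fun y hy => lt_of_lt_of_le hy (hle y)))
      (measure_ne_top_of_subset Set.inter_subset_right measure_closedBall_lt_top.ne)

/-! ### Deterministic analysis of the dynamics -/

lemma target_eq_of_dist_le {d : ℕ} {w x y : E d} {r : ℝ} (hw : w ≠ 0)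
    (hx : r < Metric.infDist x (separator w)) (hxy : dist x y ≤ r) : target w y = target w x := by
  have hw' : 0 < ‖w‖ := norm_pos_iff.2 hw
  rw [infDist_separator hw, lt_div_iff₀ hw'] at hx
  have h : |inner ℝ w x - inner ℝ w y| ≤ ‖w‖ * r := by
    rw [← inner_sub_right]
    refine (abs_real_inner_le_norm _ _).trans ?_
    rw [← dist_eq_norm]
    gcongr
  rw [abs_le] at h
  have : 0 < inner ℝ w y ↔ 0 < inner ℝ w x := by
    rcases abs_cases (inner ℝ w x) with ⟨e, h0⟩ | ⟨e, h0⟩ <;> rw [e] at hx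
    · exact ⟨fun _ => by nlinarith [dist_nonneg (x := x) (y := y)], fun _ => by nlinarith⟩
    · exact ⟨fun _ => by nlinarith, fun _ => by nlinarith⟩
  simp only [target, this]

open Classical in
/-- `goodNeighbor … t u y b` is a sufficient condition for the sensor with position `u` in the order
of moves, at location `y` and with initial state `b`, to be in its correct state when the sensor
with position `t` moves. During the first three quarters of the moves, it covers the earlier sensors
far from the separator and the later ones with a correct initial state; afterwards, it covers the
sensors which moved during the first three quarters. -/
def goodNeighbor {d : ℕ} (N : ℕ) (w : E d) (r : ℝ) (t u : ℕ) (y : E d) (b : Bool) : Prop :=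
  if 4 * t ≤ 3 * N then (if u < t then r < Metric.infDist y (separator w) else b = target w y)
  else 4 * u ≤ 3 * N

open Classical in
/-- At most half of the neighbours of the sensor with position `t`, which is far from the separator,
are good. -/
def BadMove {d N : ℕ} (w : E d) (r : ℝ) (x : Fin N → E d) (s₀ : Fin N → Bool)
    (σ : Equiv.Perm (Fin N)) (t : Fin N) : Prop :=
  r < Metric.infDist (x (σ t)) (separator w) ∧
    ((neighbors x r (σ t)).filter fun j => goodNeighbor N w r t (σ.symm j) (x j) (s₀ j)).card ≤
      ((neighbors x r (σ t)).filter fun j =>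
        ¬ goodNeighbor N w r t (σ.symm j) (x j) (s₀ j)).card

section Dynamics

variable {d N : ℕ} {x : Fin N → E d} {r : ℝ} {s₀ : Fin N → Bool} {σ : Equiv.Perm (Fin N)}
  {st : ℕ → Fin N → Bool}

lemma eq_of_isBestResponse {s : Fin N → Bool} {i : Fin N} {b c : Bool}
    (h : IsBestResponse x r s i b)
    (hc : ((neighbors x r i).filter fun j => s j ≠ c).card <
      ((neighbors x r i).filter fun j => s j = c).card) : b = c := by
  by_contra hbc
  have h1 := h c
  have hb : b = !c := by cases b <;> cases c <;> simp_all
  subst hb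
  -- A strict majority forces a neighbour to exist, so the payoff is not the default value of
  -- division by zero.
  have hpos : 0 < (neighbors x r i).card :=
    lt_of_lt_of_le (Nat.zero_lt_of_lt hc) (Finset.card_filter_le _ _)
  have e1 : ((neighbors x r i).filter fun j => s j = !c) =
      (neighbors x r i).filter fun j => s j ≠ c := by
    apply Finset.filter_congr; intro j _; cases s j <;> cases c <;> simp
  have e2 : ((neighbors x r i).filter fun j => s j ≠ !c) =
      (neighbors x r i).filter fun j => s j = c := by
    apply Finset.filter_congr; intro j _; cases s j <;> cases c <;> simp
  rw [payoff, payoff, e1, e2] at h1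
  have hpos' : (0 : ℝ) < (neighbors x r i).card := by exact_mod_cast hpos
  rw [div_le_div_iff_of_pos_right hpos'] at h1
  have hc' : (((neighbors x r i).filter fun j => s j ≠ c).card : ℝ) <
      ((neighbors x r i).filter fun j => s j = c).card := by exact_mod_cast hc
  linarith

lemma state_eq_init (h : IsRun x r s₀ σ st) {j : Fin N} {t : ℕ} (ht : t ≤ σ.symm j) :
    st t j = s₀ j := by
  induction t with
  | zero => rw [h.1]
  | succ t ih =>
    have htN : t < N := by have := (σ.symm j).2; omega
    obtain ⟨b, -, hb⟩ := h.2 ⟨t, htN⟩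
    simp only at hb
    rw [hb, Function.update_of_ne, ih (by omega)]
    rintro rfl
    simp at ht

lemma state_eq_move (h : IsRun x r s₀ σ st) {u : Fin N} {t : ℕ} (ht : (u : ℕ) < t) (htN : t ≤ N) :
    st t (σ u) = st (u + 1) (σ u) := by
  induction t, ht using Nat.le_induction with
  | base => rfl
  | succ t hut ih =>
    obtain ⟨b, -, hb⟩ := h.2 ⟨t, by omega⟩
    simp only at hb
    rw [hb, Function.update_of_ne, ih (by omega)]
    intro e
    have := congrArg Fin.val (σ.injective e)
    simp at this
    omega

lemma move_eq_of_not_badMove {w : E d} (hw : w ≠ 0) (h : IsRun x r s₀ σ st) {t : Fin N}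
    (hx : r < Metric.infDist (x (σ t)) (separator w)) (hbad : ¬ BadMove w r x s₀ σ t)
    (hgood : ∀ u : Fin N, u ≠ t → dist (x (σ t)) (x (σ u)) ≤ r →
      goodNeighbor N w r t u (x (σ u)) (s₀ (σ u)) → st t (σ u) = target w (x (σ u))) :
    st (t + 1) (σ t) = target w (x (σ t)) := by
  classical
  obtain ⟨b, hb, hst⟩ := h.2 t
  rw [hst, Function.update_self]
  apply eq_of_isBestResponse hb
  have hlt := not_le.1 fun hle => hbad ⟨hx, hle⟩
  have key : ∀ j ∈ neighbors x r (σ t), goodNeighbor N w r t (σ.symm j) (x j) (s₀ j) →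
      st t j = target w (x (σ t)) := by
    intro j hj hg
    simp only [neighbors, Finset.mem_filter, Finset.mem_univ, true_and] at hj
    have := hgood (σ.symm j) (fun e => hj.1 (by rw [← e]; simp)) (by simpa using hj.2)
      (by simpa using hg)
    simp only [Equiv.apply_symm_apply] at this
    rw [this, target_eq_of_dist_le hw hx hj.2]
  refine (Finset.card_le_card ?_).trans_lt (hlt.trans_le (Finset.card_le_card ?_))
  · intro j hj
    rw [Finset.mem_filter] at hj ⊢
    exact ⟨hj.1, fun hg => hj.2 (key j hj.1 hg)⟩
  · intro j hj
    rw [Finset.mem_filter] at hj ⊢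
    exact ⟨hj.1, key j hj.1 hj.2⟩

/-- Strong induction on time: a good neighbour that has moved is correct by induction, and one that
has not still holds its correct initial state. -/
lemma early_move_eq {w : E d} (hw : w ≠ 0) (h : IsRun x r s₀ σ st)
    (hbad : ∀ t, ¬ BadMove w r x s₀ σ t) (n : ℕ) : ∀ t : Fin N, (t : ℕ) = n → 4 * n ≤ 3 * N →
      r < Metric.infDist (x (σ t)) (separator w) → st (t + 1) (σ t) = target w (x (σ t)) := by
  induction n using Nat.strong_induction_on with
  | _ n ih =>
    rintro t rfl htN hx
    refine move_eq_of_not_badMove hw h hx (hbad t) fun u hu hdist hg => ?_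
    simp only [goodNeighbor, htN, if_true] at hg
    split_ifs at hg with hut
    · rw [state_eq_move h hut t.2.le]
      exact ih u hut u rfl (by omega) hg
    · rw [state_eq_init h (by simpa using hut), hg]

lemma farSensorsUpdateCorrectly_of_not_badMove {w : E d} (hw : w ≠ 0) (hr : 0 < r)
    (hbad : ∀ t, ¬ BadMove w r x s₀ σ t) : FarSensorsUpdateCorrectly w r x s₀ σ := by
  intro st h t hx
  have hx' : r < Metric.infDist (x (σ t)) (separator w) := by linarith
  by_cases htN : 4 * (t : ℕ) ≤ 3 * N
  · exact early_move_eq hw h hbad t t rfl htN hx'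
  · refine move_eq_of_not_badMove hw h hx' (hbad t) fun u hu hdist hg => ?_
    simp only [goodNeighbor, htN, if_false] at hg
    rw [state_eq_move h (by omega) t.2.le]
    refine early_move_eq hw h hbad u u rfl hg ?_
    have := Metric.infDist_le_infDist_add_dist (s := separator w) (x := x (σ t)) (y := x (σ u))
    linarith

end Dynamics

/-! ### Exponential weights and their measurability -/

open Classical in
/-- The factor by which the sensor with position `u`, at location `y` and with initial state `b`,
contributes to the exponential moment of the sensor with position `t`, at location `z`. -/
def neighborWeight {d : ℕ} (N : ℕ) (w : E d) (r lam : ℝ) (t u : ℕ) (z y : E d) (b : Bool) :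
    ENNReal :=
  if dist z y ≤ r then
    (if goodNeighbor N w r t u y b then ENNReal.ofReal (Real.exp (-lam))
      else ENNReal.ofReal (Real.exp lam))
  else 1

open Classical in
/-- The indicator of the event that the sensor with position `t` is far from the separator, times
`exp (lam * (B - G))`, where `G` and `B` are its numbers of good and of other neighbours. -/
def moveWeight {d N : ℕ} (w : E d) (r lam : ℝ) (x : Fin N → E d) (s₀ : Fin N → Bool)
    (σ : Equiv.Perm (Fin N)) (t : Fin N) : ENNReal :=
  (if r < Metric.infDist (x (σ t)) (separator w) then 1 else 0) *
    ∏ j ∈ Finset.univ.erase (σ t),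
      neighborWeight N w r lam t (σ.symm j) (x (σ t)) (x j) (s₀ j)

lemma one_le_moveWeight {d N : ℕ} {w : E d} {r lam : ℝ} (hlam : 0 ≤ lam) {x : Fin N → E d}
    {s₀ : Fin N → Bool} {σ : Equiv.Perm (Fin N)} {t : Fin N} (h : BadMove w r x s₀ σ t) :
    1 ≤ moveWeight w r lam x s₀ σ t := by
  classical
  obtain ⟨h1, h2⟩ := h
  rw [moveWeight, if_pos h1, one_mul]
  have e1 : ∏ j ∈ Finset.univ.erase (σ t),
      neighborWeight N w r lam t (σ.symm j) (x (σ t)) (x j) (s₀ j) =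
      ∏ j ∈ neighbors x r (σ t),
        (if goodNeighbor N w r t (σ.symm j) (x j) (s₀ j) then ENNReal.ofReal (Real.exp (-lam))
          else ENNReal.ofReal (Real.exp lam)) := by
    simp only [neighborWeight]
    rw [← Finset.prod_filter]
    refine Finset.prod_congr ?_ fun _ _ => rfl
    ext j
    simp [neighbors]
  rw [e1, Finset.prod_ite, Finset.prod_const, Finset.prod_const]
  rw [← ENNReal.ofReal_pow (Real.exp_pos _).le, ← ENNReal.ofReal_pow (Real.exp_pos _).le,
    ← ENNReal.ofReal_mul (by positivity), ← Real.exp_nat_mul, ← Real.exp_nat_mul, ← Real.exp_add,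
    ENNReal.one_le_ofReal, Real.one_le_exp_iff]
  have h2' : (((neighbors x r (σ t)).filter fun j =>
      goodNeighbor N w r t (σ.symm j) (x j) (s₀ j)).card : ℝ) ≤
      ((neighbors x r (σ t)).filter fun j =>
        ¬ goodNeighbor N w r t (σ.symm j) (x j) (s₀ j)).card := by
    exact_mod_cast h2
  nlinarith

lemma measurableSet_lt_infDist {d : ℕ} (w : E d) (r : ℝ) :
    MeasurableSet {y : E d | r < Metric.infDist y (separator w)} :=
  measurableSet_lt measurable_const (continuous_infDist_separator w).measurable

lemma measurable_target {d : ℕ} (w : E d) : Measurable (target w) := by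
  apply measurable_to_bool
  have : target w ⁻¹' {true} = {y : E d | 0 < inner ℝ w y} := by
    ext y; simp [target]
  rw [this]
  exact measurableSet_lt measurable_const
    (by fun_prop : Continuous fun y : E d => inner ℝ w y).measurable

lemma measurableSet_goodNeighbor {d : ℕ} (N : ℕ) (w : E d) (r : ℝ) (t u : ℕ) :
    MeasurableSet {p : E d × E d × Bool | goodNeighbor N w r t u p.2.1 p.2.2} := by
  unfold goodNeighbor
  split_ifs
  · exact (measurableSet_lt_infDist w r).preimage (by fun_prop)
  · exact measurableSet_eq_fun (by fun_prop) ((measurable_target w).comp (by fun_prop))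
  · exact MeasurableSet.const _

lemma measurable_neighborWeight {d : ℕ} (N : ℕ) (w : E d) (r lam : ℝ) (t u : ℕ) :
    Measurable fun p : E d × E d × Bool => neighborWeight N w r lam t u p.1 p.2.1 p.2.2 := by
  classical
  unfold neighborWeight
  refine Measurable.ite (measurableSet_le (by fun_prop) measurable_const) ?_ measurable_const
  exact Measurable.ite (measurableSet_goodNeighbor N w r t u) measurable_const measurable_const

lemma measurable_moveWeight {d N : ℕ} (w : E d) (r lam : ℝ) (σ : Equiv.Perm (Fin N)) (t : Fin N) :
    Measurable fun p : (Fin N → E d) × (Fin N → Bool) => moveWeight w r lam p.1 p.2 σ t := by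
  classical
  unfold moveWeight
  refine Measurable.mul (Measurable.ite ((measurableSet_lt_infDist w r).preimage (by fun_prop))
    measurable_const measurable_const) (Finset.measurable_prod _ fun j _ => ?_)
  exact (measurable_neighborWeight N w r lam t (σ.symm j)).comp
    (f := fun p : (Fin N → E d) × (Fin N → Bool) => (p.1 (σ t), p.1 j, p.2 j)) (by fun_prop)

open Classical in
-- The form isolates `μ (B ∩ F)`: when `a ≤ b`, a lower bound on it bounds the integral above. It
-- serves for the states and for the locations.
lemma lintegral_ite_ite {α : Type*} [MeasurableSpace α] {μ : Measure α} [IsProbabilityMeasure μ]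
    {B F : Set α} (hB : MeasurableSet B) (hF : MeasurableSet F) {a b : ℝ} (ha : 0 ≤ a)
    (hb : 0 ≤ b) :
    ∫⁻ y, (if y ∈ B then (if y ∈ F then ENNReal.ofReal a else ENNReal.ofReal b) else 1) ∂μ =
      ENNReal.ofReal (1 + μ.real B * (b - 1) - μ.real (B ∩ F) * (b - a)) := by
  have e : ∀ y, (if y ∈ B then (if y ∈ F then ENNReal.ofReal a else ENNReal.ofReal b) else 1) =
      (B ∩ F).indicator (fun _ => ENNReal.ofReal a) y +
        ((B \ F).indicator (fun _ => ENNReal.ofReal b) y +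
          Bᶜ.indicator (fun _ => ENNReal.ofReal 1) y) := by
    intro y
    by_cases h1 : y ∈ B <;> by_cases h2 : y ∈ F <;> simp [h1, h2]
  simp only [e]
  rw [lintegral_add_left (measurable_const.indicator (hB.inter hF)),
    lintegral_add_left (measurable_const.indicator (hB.diff hF)),
    lintegral_indicator_const (hB.inter hF), lintegral_indicator_const (hB.diff hF),
    lintegral_indicator_const hB.compl, ← ofReal_measureReal, ← ofReal_measureReal,
    ← ofReal_measureReal,
    ← ENNReal.ofReal_mul ha, ← ENNReal.ofReal_mul hb, ← ENNReal.ofReal_mul zero_le_one,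
    ← ENNReal.ofReal_add (by positivity) (by positivity),
    ← ENNReal.ofReal_add (by positivity) (by positivity)]
  congr 1
  have h1 := measureReal_inter_add_sdiff (μ := μ) (s := B) hF
  have h2 := probReal_compl_eq_one_sub (μ := μ) hB
  rw [h2, ← h1]
  ring

/-- Locations are independent: integrate a product over the sensors other than `i` conditionally
on the location of `i`. -/
lemma lintegral_pi_mul_prod_erase {α : Type*} [MeasurableSpace α] {N : ℕ} (μ : Measure α)
    [IsProbabilityMeasure μ] (i : Fin N) {F : α → ENNReal} (hF : Measurable F)
    {g : Fin N → α → α → ENNReal} (hg : ∀ j, Measurable fun p : α × α => g j p.1 p.2) :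
    ∫⁻ x, F (x i) * ∏ j ∈ Finset.univ.erase i, g j (x i) (x j) ∂(Measure.pi fun _ : Fin N => μ) =
      ∫⁻ z, F z * ∏ j ∈ Finset.univ.erase i, ∫⁻ y, g j z y ∂μ ∂μ := by
  obtain ⟨n, rfl⟩ : ∃ n, N = n + 1 := ⟨N - 1, by have := i.2; omega⟩
  have hprod : ∀ f : Fin (n + 1) → ENNReal,
      ∏ j ∈ Finset.univ.erase i, f j = ∏ k : Fin n, f (i.succAbove k) := by
    intro f
    rw [Fin.univ_succAbove n i, Finset.erase_cons, Finset.prod_map]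
    rfl
  simp only [hprod]
  have hm : Measurable fun p : α × (Fin n → α) =>
      F p.1 * ∏ k : Fin n, g (i.succAbove k) p.1 (p.2 k) := by
    refine (hF.comp measurable_fst).mul (Finset.measurable_prod _ fun k _ => ?_)
    exact (hg (i.succAbove k)).comp (f := fun p : α × (Fin n → α) => (p.1, p.2 k)) (by fun_prop)
  have hmp := measurePreserving_piFinSuccAbove (fun _ : Fin (n + 1) => μ) i
  have e1 := hmp.lintegral_comp hm
  refine Eq.trans ?_ (e1.trans ?_)
  · rfl
  · rw [lintegral_prod _ hm.aemeasurable]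
    refine lintegral_congr fun z => ?_
    have hgz : ∀ k : Fin n, Measurable (g (i.succAbove k) z) := fun k =>
      (hg (i.succAbove k)).comp (f := fun y : α => (z, y)) (by fun_prop)
    simp only
    have hgm : Measurable fun x : Fin n → α => ∏ k, g (i.succAbove k) z (x k) :=
      Finset.measurable_prod _ fun k _ => (hgz k).comp (measurable_pi_apply k)
    rw [lintegral_const_mul _ hgm]
    congr 1
    have hind : iIndepFun (fun (k : Fin n) (x : Fin n → α) => g (i.succAbove k) z (x k))
        (Measure.pi fun _ : Fin n => μ) :=
      iIndepFun_pi (fun k => (hgz k).aemeasurable)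
    rw [lintegral_prod_eq_prod_lintegral_of_indepFun _ _ hind
      (fun k => (hgz k).comp (measurable_pi_apply k))]
    refine Finset.prod_congr rfl fun k _ => ?_
    exact (measurePreserving_eval (fun _ : Fin n => μ) k).lintegral_comp (hgz k)

/-! ### Expected weight of one neighbour, and the sum over neighbours -/

/-- The set of locations at which an early enough sensor counts as good. -/
def goodLocations {d : ℕ} (N : ℕ) (w : E d) (r : ℝ) (t u : ℕ) : Set (E d) :=
  {y | 4 * t ≤ 3 * N → u < t → r < Metric.infDist y (separator w)}

/-- The expected weight of a neighbour in `goodLocations`, given the locations. -/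
def goodFactor (N : ℕ) (lam γ : ℝ) (t u : ℕ) : ℝ :=
  if 4 * t ≤ 3 * N then
    (if u < t then Real.exp (-lam)
      else (1 / 2 + γ) * Real.exp (-lam) + (1 / 2 - γ) * Real.exp lam)
  else (if 4 * u ≤ 3 * N then Real.exp (-lam) else Real.exp lam)

/-- A bound on the expected weight of a neighbour. -/
def meanFactor (N : ℕ) (lam γ : ℝ) (t u : ℕ) : ℝ :=
  if 4 * t ≤ 3 * N then
    (if u < t then (1 / 2 - γ / 64) * Real.exp (-lam) + (1 / 2 + γ / 64) * Real.exp lam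
      else (1 / 2 + γ) * Real.exp (-lam) + (1 / 2 - γ) * Real.exp lam)
  else (if 4 * u ≤ 3 * N then Real.exp (-lam) else Real.exp lam)

open Classical in
/-- A bound on the expected weight of a sensor given the locations. -/
def conditionalWeight {d : ℕ} (N : ℕ) (w : E d) (r lam γ : ℝ) (t u : ℕ) (z y : E d) : ENNReal :=
  if y ∈ Metric.closedBall z r then
    (if y ∈ goodLocations N w r t u then ENNReal.ofReal (goodFactor N lam γ t u)
      else ENNReal.ofReal (Real.exp lam))
  else 1

lemma goodFactor_nonneg {N : ℕ} {lam γ : ℝ} (hγ0 : 0 ≤ γ) (hγ : γ ≤ 1 / 2) (t u : ℕ) :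
    0 ≤ goodFactor N lam γ t u := by
  have : 0 ≤ 1 / 2 - γ := by linarith
  unfold goodFactor
  split_ifs <;> positivity

lemma measurableSet_goodLocations {d : ℕ} (N : ℕ) (w : E d) (r : ℝ) (t u : ℕ) :
    MeasurableSet (goodLocations N w r t u) := by
  by_cases h : 4 * t ≤ 3 * N ∧ u < t
  · convert measurableSet_lt_infDist w r using 1
    ext y; simp [goodLocations, h]
  · convert MeasurableSet.univ using 1
    ext y
    simp only [goodLocations, Set.mem_ofPred_eq, Set.mem_univ, iff_true]
    exact fun h1 h2 => absurd ⟨h1, h2⟩ h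

lemma measurable_conditionalWeight {d : ℕ} (N : ℕ) (w : E d) (r lam γ : ℝ) (t u : ℕ) :
    Measurable fun p : E d × E d => conditionalWeight N w r lam γ t u p.1 p.2 := by
  classical
  unfold conditionalWeight
  refine Measurable.ite (measurableSet_le (f := fun p : E d × E d => dist p.2 p.1) (by fun_prop)
    measurable_const) ?_ measurable_const
  exact Measurable.ite ((measurableSet_goodLocations N w r t u).preimage measurable_snd)
    measurable_const measurable_const

lemma lintegral_neighborWeight_le {d N : ℕ} {w z y : E d} {r lam η : ℝ} {t u : ℕ}
    (hlam : 0 ≤ lam) {ρ : Measure (Fin N → Bool)}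
    [IsProbabilityMeasure ρ] {j : Fin N}
    (hρ : ENNReal.ofReal (1 - η) ≤ ρ {s | s j = target w y}) :
    ∫⁻ s, neighborWeight N w r lam t u z y (s j) ∂ρ ≤
      conditionalWeight N w r lam (1 / 2 - η) t u z y := by
  classical
  unfold neighborWeight conditionalWeight
  rw [Metric.mem_closedBall']
  by_cases hzy : dist z y ≤ r
  · simp only [hzy, if_true, goodNeighbor, goodLocations, goodFactor, Set.mem_ofPred_eq]
    by_cases ht : 4 * t ≤ 3 * N
    · by_cases hlt : u < t
      · by_cases hr : r < Metric.infDist y (separator w) <;> simp [ht, hlt, hr]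
      · simp only [ht, hlt, if_true, if_false, false_imp_iff, imp_true_iff]
        have hexp : Real.exp (-lam) ≤ Real.exp lam := Real.exp_le_exp.2 (by linarith)
        have h := lintegral_ite_ite (μ := ρ) (B := Set.univ) (F := {s | s j = target w y})
          MeasurableSet.univ (measurableSet_eq_fun (by fun_prop) measurable_const)
          (Real.exp_pos (-lam)).le (Real.exp_pos lam).le
        simp only [Set.mem_univ, if_true, Set.mem_ofPred_eq, Set.univ_inter, probReal_univ] at h
        refine le_trans (le_of_eq (Eq.trans ?_ h)) (ENNReal.ofReal_le_ofReal ?_)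
        · congr!
        have hq : 1 - η ≤ ρ.real {s | s j = target w y} :=
          (ENNReal.ofReal_le_iff_le_toReal (measure_ne_top _ _)).1 hρ
        have := mul_le_mul_of_nonneg_right hq (sub_nonneg.2 hexp)
        linarith
    · by_cases hu : 4 * u ≤ 3 * N <;> simp [ht, hu]
  · simp [hzy]

lemma lintegral_conditionalWeight_le {d : ℕ} (hd : 1 ≤ d) {N : ℕ} {w z : E d} {r lam γ : ℝ}
    (t u : ℕ) (hw : w ≠ 0) (hz : ‖z‖ ≤ 1) (hr : 0 < r) (hrd : 4096 * (r * √d) ≤ γ) (hγ : γ ≤ 1 / 2)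
    (hlam : 0 ≤ lam) (h1 : r < Metric.infDist z (separator w)) :
    ∫⁻ y, conditionalWeight N w r lam γ t u z y ∂(uniformBall d) ≤
      ENNReal.ofReal (Real.exp ((uniformBall d).real (Metric.closedBall z r) *
        (meanFactor N lam γ t u - 1))) := by
  classical
  have hγ0 : 0 ≤ γ := le_trans (by positivity) hrd
  unfold conditionalWeight
  rw [lintegral_ite_ite measurableSet_closedBall (measurableSet_goodLocations N w r t u)
    (goodFactor_nonneg hγ0 hγ t u) (Real.exp_pos lam).le]
  apply ENNReal.ofReal_le_ofReal
  rw [add_sub_assoc]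
  -- Exponentiating turns the product over neighbours into a sum of mean factors.
  refine le_trans ?_ (Real.add_one_le_exp _)
  rw [add_comm]
  gcongr ?_ + 1
  set p := (uniformBall d).real (Metric.closedBall z r) with hp
  by_cases h : 4 * t ≤ 3 * N ∧ u < t
  · have e : goodLocations N w r t u = {y | r < Metric.infDist y (separator w)} := by
      ext y; simp [goodLocations, h]
    have hhalf := half_uniformBall_le hd hw hz hr hrd hγ h1
    have hexp : Real.exp (-lam) ≤ Real.exp lam := Real.exp_le_exp.2 (by linarith)
    rw [e]
    simp only [goodFactor, meanFactor, h, if_true]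
    have := mul_le_mul_of_nonneg_right hhalf (sub_nonneg.2 hexp)
    rw [← hp] at this
    linarith
  · have e : goodLocations N w r t u = Set.univ := by
      ext y
      simp only [goodLocations, Set.mem_ofPred_eq, Set.mem_univ, iff_true]
      exact fun h1 h2 => absurd ⟨h1, h2⟩ h
    have e2 : goodFactor N lam γ t u = meanFactor N lam γ t u := by
      by_cases ht : 4 * t ≤ 3 * N
      · have : ¬ u < t := fun hu => h ⟨ht, hu⟩
        simp [goodFactor, meanFactor, ht, this]
      · simp [goodFactor, meanFactor, ht]
    rw [e, Set.inter_univ, e2, ← hp]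
    linarith

lemma exp_le_one_add {x : ℝ} (h : |x| ≤ 1) : Real.exp x ≤ 1 + x + x ^ 2 := by
  have := Real.abs_exp_sub_one_sub_id_le h
  rw [abs_le] at this
  linarith [this.2]

lemma sum_range_ite_le {N m : ℕ} (hm : m ≤ N) (a b : ℝ) :
    ∑ u ∈ Finset.range N, (if u < m then a else b) = m * a + (N - m) * b := by
  obtain ⟨k, rfl⟩ := Nat.exists_eq_add_of_le hm
  rw [Finset.sum_range_add, Finset.sum_congr rfl (fun u hu => if_pos (Finset.mem_range.1 hu))]
  simp

/-- Early on, each sensor that has moved costs at most `γ²/128` and each other one gains `31γ²/256`;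
at `t = 3N/4` the total is `-25Nγ²/1024`, up to the mover's own term, which `N ≥ 14` absorbs. Later
the drift is of first order, about `-Nγ/32`. -/
lemma sum_meanFactor_le {N t : ℕ} {γ : ℝ} (hγ0 : 0 < γ) (hγ : γ ≤ 1 / 2) (hN : 14 ≤ N)
    (ht : t < N) :
    ∑ u ∈ Finset.range N, (meanFactor N (γ / 16) γ t u - 1) - (meanFactor N (γ / 16) γ t t - 1) ≤
      -(N * γ ^ 2 / 64) := by
  have hN' : (14 : ℝ) ≤ N := by exact_mod_cast hN
  have hx1 : Real.exp (γ / 16) ≤ 1 + γ / 16 + (γ / 16) ^ 2 :=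
    exp_le_one_add (by rw [abs_le]; constructor <;> linarith)
  have hx2 : Real.exp (-(γ / 16)) ≤ 1 + -(γ / 16) + (-(γ / 16)) ^ 2 :=
    exp_le_one_add (by rw [abs_le]; constructor <;> linarith)
  set a := Real.exp (-(γ / 16)) with ha
  set b := Real.exp (γ / 16) with hb
  have hb0 : 1 + γ / 16 ≤ b := by have := Real.add_one_le_exp (γ / 16); linarith
  by_cases h : 4 * t ≤ 3 * N
  · simp only [meanFactor, h, if_true, lt_irrefl, if_false, apply_ite (· - (1 : ℝ))]
    rw [← ha, ← hb, sum_range_ite_le ht.le]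
    have h' : 4 * (t : ℝ) ≤ 3 * N := by exact_mod_cast h
    have hA : (1 / 2 - γ / 64) * a + (1 / 2 + γ / 64) * b - 1 ≤ γ ^ 2 / 128 := by
      have e1 := mul_le_mul_of_nonneg_left hx2 (by linarith : 0 ≤ 1 / 2 - γ / 64)
      have e2 := mul_le_mul_of_nonneg_left hx1 (by linarith : 0 ≤ 1 / 2 + γ / 64)
      nlinarith
    have hB : (1 / 2 + γ) * a + (1 / 2 - γ) * b - 1 ≤ -(31 * γ ^ 2 / 256) := by
      have e1 := mul_le_mul_of_nonneg_left hx2 (by linarith : 0 ≤ 1 / 2 + γ)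
      have e2 := mul_le_mul_of_nonneg_left hx1 (by linarith : 0 ≤ 1 / 2 - γ)
      nlinarith
    have ht1 : (t : ℝ) + 1 ≤ N := by exact_mod_cast ht
    have s1 := mul_le_mul_of_nonneg_left hA (Nat.cast_nonneg (α := ℝ) t)
    have s2 := mul_le_mul_of_nonneg_left hB (by linarith : (0 : ℝ) ≤ N - t - 1)
    have s3 := mul_le_mul_of_nonneg_left h' (sq_nonneg γ)
    have s4 := mul_le_mul_of_nonneg_left hN' (sq_nonneg γ)
    nlinarith
  · have e : ∀ u, (4 * u ≤ 3 * N ↔ u < 3 * N / 4 + 1) := fun u => by omega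
    simp only [meanFactor, h, if_false, apply_ite (· - (1 : ℝ))]
    rw [← ha, ← hb]
    simp only [e]
    rw [sum_range_ite_le (by omega)]
    have hm : 3 * (N : ℝ) ≤ 4 * ((3 * N / 4 + 1 : ℕ) : ℝ) := by
      exact_mod_cast (by omega : 3 * N ≤ 4 * (3 * N / 4 + 1))
    have hm2 : ((3 * N / 4 + 1 : ℕ) : ℝ) ≤ N := by
      exact_mod_cast (by omega : 3 * N / 4 + 1 ≤ N)
    set m : ℝ := ((3 * N / 4 + 1 : ℕ) : ℝ) with hmdef
    have s1 := mul_le_mul_of_nonneg_left hx2 (by linarith : (0 : ℝ) ≤ m)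
    have s2 := mul_le_mul_of_nonneg_left hx1 (by linarith : (0 : ℝ) ≤ N - m)
    have s3 := mul_le_mul_of_nonneg_left hm hγ0.le
    have s4 : (N : ℝ) * γ ^ 2 ≤ N * γ / 2 := by
      have := mul_le_mul_of_nonneg_left hγ (by positivity : (0 : ℝ) ≤ N * γ)
      linarith
    nlinarith

/-! ### Chernoff bound for a single move -/

lemma lintegral_moveWeight_kernel_le {d N : ℕ} {w : E d} {r lam η : ℝ} (hlam : 0 ≤ lam)
    (σ : Equiv.Perm (Fin N)) (t : Fin N) {x : Fin N → E d} {ρ : Measure (Fin N → Bool)}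
    [IsProbabilityMeasure ρ] (hind : iIndepFun (fun (i : Fin N) (s : Fin N → Bool) => s i) ρ)
    (hρ : ∀ i : Fin N, ENNReal.ofReal (1 - η) ≤ ρ {s | s i = target w (x i)}) :
    ∫⁻ s, moveWeight w r lam x s σ t ∂ρ ≤
      {z | r < Metric.infDist z (separator w)}.indicator 1 (x (σ t)) *
        ∏ j ∈ Finset.univ.erase (σ t),
          conditionalWeight N w r lam (1 / 2 - η) t (σ.symm j) (x (σ t)) (x j) := by
  classical
  unfold moveWeight
  rw [lintegral_const_mul _ (measurable_of_finite _)]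
  gcongr ?_ * ?_
  · simp [Set.indicator_apply]
  · let X : Fin N → Bool → ENNReal := fun j b =>
      neighborWeight N w r lam t (σ.symm j) (x (σ t)) (x j) b
    have hX : iIndepFun (fun (j : Fin N) (s : Fin N → Bool) => X j (s j)) ρ :=
      hind.comp X fun _ => measurable_of_finite _
    have hprod := lintegral_prod_eq_prod_lintegral_of_indepFun (Finset.univ.erase (σ t)) _ hX
      fun _ => measurable_of_finite _
    refine hprod.le.trans ?_
    exact Finset.prod_le_prod' fun j _ => lintegral_neighborWeight_le hlam (hρ j)

lemma lintegral_moveWeight_le {d N : ℕ} (hd : 1 ≤ d) {w : E d} {r η : ℝ}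
    {κ : Kernel (Fin N → E d) (Fin N → Bool)} [IsMarkovKernel κ] (hκ : HasNoiseRate w η κ)
    (hw : w ≠ 0) (hη0 : 0 ≤ η) (hη : η < 1 / 2) (hr : 0 < r)
    (hrd : 4096 * (r * √d) ≤ 1 / 2 - η) (hN : 14 ≤ N) (σ : Equiv.Perm (Fin N)) (t : Fin N) :
    ∫⁻ p, moveWeight w r ((1 / 2 - η) / 16) p.1 p.2 σ t ∂((locationLaw d N).compProd κ) ≤
      ENNReal.ofReal (Real.exp (-((r / 2) ^ d * (N * (1 / 2 - η) ^ 2 / 64)))) := by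
  set γ := 1 / 2 - η with hγ
  set lam := γ / 16 with hlamdef
  have hγ0 : 0 < γ := by linarith
  have hlam : 0 ≤ lam := by positivity
  have hd' : (1 : ℝ) ≤ √d := by
    rw [Real.one_le_sqrt]; exact_mod_cast hd
  have hr1 : r ≤ 1 := by nlinarith
  have : IsProbabilityMeasure (locationLaw d N) := by unfold locationLaw; infer_instance
  rw [Measure.lintegral_compProd (measurable_moveWeight w r lam σ t)]
  have h1 : ∫⁻ x, ∫⁻ s, moveWeight w r lam x s σ t ∂(κ x) ∂(locationLaw d N) ≤
      ∫⁻ x, {z | r < Metric.infDist z (separator w)}.indicator 1 (x (σ t)) *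
        ∏ j ∈ Finset.univ.erase (σ t),
          conditionalWeight N w r lam γ t (σ.symm j) (x (σ t)) (x j) ∂(locationLaw d N) := by
    refine lintegral_mono_ae ?_
    filter_upwards [hκ] with x hx
    exact lintegral_moveWeight_kernel_le hlam σ t hx.1 hx.2
  refine h1.trans ?_
  rw [locationLaw, lintegral_pi_mul_prod_erase (uniformBall d) (σ t)
    (measurable_one.indicator (measurableSet_lt_infDist w r))
    (fun j => measurable_conditionalWeight N w r lam γ t (σ.symm j))]
  have h2 : ∀ᵐ z ∂(uniformBall d),
      {z | r < Metric.infDist z (separator w)}.indicator (1 : E d → ENNReal) z *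
        ∏ j ∈ Finset.univ.erase (σ t),
          ∫⁻ y, conditionalWeight N w r lam γ t (σ.symm j) z y ∂(uniformBall d) ≤
      ENNReal.ofReal (Real.exp (-((r / 2) ^ d * (N * γ ^ 2 / 64)))) := by
    filter_upwards [ae_uniformBall_norm_le d] with z hz
    by_cases hzr : r < Metric.infDist z (separator w)
    · rw [Set.indicator_of_mem (by exact hzr), Pi.one_apply, one_mul]
      refine (Finset.prod_le_prod' fun j _ => lintegral_conditionalWeight_le hd t (σ.symm j) hw hz
        hr hrd (by linarith) hlam hzr).trans ?_
      rw [← ENNReal.ofReal_prod_of_nonneg fun _ _ => (Real.exp_pos _).le, ← Real.exp_sum,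
        ← Finset.mul_sum]
      apply ENNReal.ofReal_le_ofReal
      rw [Real.exp_le_exp]
      -- Reindexing by position removes `σ`, so the bound is uniform in the order.
      have hs : ∑ j ∈ Finset.univ.erase (σ t), (meanFactor N lam γ t (σ.symm j) - 1) =
          ∑ u ∈ Finset.range N, (meanFactor N lam γ t u - 1) - (meanFactor N lam γ t t - 1) := by
        rw [Finset.sum_erase_eq_sub (Finset.mem_univ (σ t)), Equiv.symm_apply_apply,
          Equiv.sum_comp σ.symm fun u : Fin N => meanFactor N lam γ t u - 1,
          Fin.sum_univ_eq_sum_range fun u => meanFactor N lam γ t u - 1]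
      rw [hs]
      have hp := pow_le_uniformBall hz hr hr1
      have hsum := sum_meanFactor_le hγ0 (by linarith) hN t.2
      have hp0 : 0 ≤ (r / 2) ^ d := by positivity
      have hA : 0 ≤ N * γ ^ 2 / 64 := by positivity
      have m1 := mul_le_mul_of_nonneg_left hsum (hp0.trans hp)
      have m2 := mul_le_mul_of_nonneg_right hp hA
      linarith
    · rw [Set.indicator_of_notMem (by exact hzr), zero_mul]
      exact zero_le
  refine (lintegral_mono_ae h2).trans ?_
  simp

instance isProbabilityMeasure_orderLaw (N : ℕ) : IsProbabilityMeasure (orderLaw N) :=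
  PMF.toMeasure.isProbabilityMeasure _

lemma law_badMove_le {d N : ℕ} {w : E d} {r lam : ℝ} (hlam : 0 ≤ lam)
    {κ : Kernel (Fin N → E d) (Fin N → Bool)} [IsMarkovKernel κ] {ε : ENNReal} (t : Fin N)
    (h : ∀ σ : Equiv.Perm (Fin N),
      ∫⁻ p, moveWeight w r lam p.1 p.2 σ t ∂((locationLaw d N).compProd κ) ≤ ε) :
    law κ {ω | BadMove w r ω.1.1 ω.1.2 ω.2 t} ≤ ε := by
  have : IsProbabilityMeasure (locationLaw d N) := by unfold locationLaw; infer_instance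
  have hm : Measurable fun ω : ((Fin N → E d) × (Fin N → Bool)) × Equiv.Perm (Fin N) =>
      moveWeight w r lam ω.1.1 ω.1.2 ω.2 t :=
    measurable_from_prod_countable_left fun σ => measurable_moveWeight w r lam σ t
  calc law κ {ω | BadMove w r ω.1.1 ω.1.2 ω.2 t}
      ≤ law κ {ω | 1 ≤ moveWeight w r lam ω.1.1 ω.1.2 ω.2 t} :=
        measure_mono fun ω hω => one_le_moveWeight hlam hω
    _ ≤ ∫⁻ ω, moveWeight w r lam ω.1.1 ω.1.2 ω.2 t ∂(law κ) := by
        simpa using mul_meas_ge_le_lintegral₀ (μ := law κ) hm.aemeasurable 1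
    _ ≤ ε := by
        rw [law, lintegral_prod_symm _ hm.aemeasurable]
        refine (lintegral_mono h).trans ?_
        simp

/-! ### Size of `N` and the union bound -/

lemma exp_tail_le {d N : ℕ} (hd : 1 ≤ d) {r γ δ : ℝ} (hr : 0 < r) (hr1 : r ≤ 1 / 8192)
    (hγ0 : 0 < γ) (hγ : γ ≤ 1 / 2) (hδ0 : 0 < δ) (hδ : δ < 1)
    (hN : 384 / ((r / 2) ^ d * γ ^ 2) * Real.log (1 / (r ^ d * γ * δ)) ≤ N) :
    14 ≤ N ∧ N * Real.exp (-((r / 2) ^ d * (N * γ ^ 2 / 64))) ≤ δ := by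
  set p := (r / 2) ^ d with hp
  set q := r ^ d with hq
  have hp0 : 0 < p := by positivity
  have hq0 : 0 < q := by positivity
  have hqr : q ≤ r := by
    calc q ≤ r ^ 1 := pow_le_pow_of_le_one hr.le (by linarith) hd
      _ = r := pow_one r
  have hpr : p ≤ r := by
    calc p ≤ q := by rw [hp, hq]; gcongr; linarith
      _ ≤ r := hqr
  have hqp : q * q ≤ p := by
    rw [hp, hq, ← mul_pow]; gcongr; nlinarith
  set a := q * γ * δ with ha
  have ha0 : 0 < a := by positivity
  have ha1 : a ≤ 1 / 8192 := by
    have : γ * δ ≤ 1 := by nlinarith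
    calc a = q * (γ * δ) := by rw [ha]; ring
      _ ≤ q * 1 := by gcongr
      _ ≤ _ := by linarith
  set L := Real.log (1 / a) with hL
  have hL1 : 1 ≤ L := by
    rw [hL, Real.le_log_iff_exp_le (by positivity), le_div_iff₀ ha0]
    have := Real.exp_one_lt_d9
    nlinarith
  have hpg : 0 < p * γ ^ 2 := by positivity
  rw [div_mul_eq_mul_div, div_le_iff₀ hpg] at hN
  have hpg1 : p * γ ^ 2 ≤ 1 := by nlinarith [sq_nonneg γ]
  have hN0 : (0 : ℝ) ≤ N := by positivity
  have hN384 : (384 : ℝ) ≤ N := by nlinarith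
  refine ⟨by exact_mod_cast (by linarith : (14 : ℝ) ≤ N), ?_⟩
  set M := p * (N * γ ^ 2 / 64) with hM
  -- Here `384 = 6 * 64`. Half of `M` absorbs the factor `N`; the other half gives `a ^ 3`, where
  -- two powers yield `q² ≤ p` and `γ²`, and the third beats 64.
  have hM6 : 6 * L ≤ M := by rw [hM]; linarith
  have hexpL : Real.exp (-L) = a := by
    rw [hL, one_div, Real.log_inv, neg_neg, Real.exp_log ha0]
  have h1 : M * Real.exp (-M) ≤ Real.exp (-(M / 2)) := by
    have e : Real.exp (-(M / 2)) = Real.exp (M / 2) * Real.exp (-M) := by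
      rw [← Real.exp_add]; congr 1; ring
    rw [e]
    gcongr
    have := Real.quadratic_le_exp_of_nonneg (x := M / 2) (by linarith)
    nlinarith [sq_nonneg (M - 2)]
  have h2 : Real.exp (-(M / 2)) ≤ a ^ 3 := by
    rw [← hexpL, ← Real.exp_nat_mul, Real.exp_le_exp]
    push_cast
    linarith
  have h3 : N * (p * γ ^ 2) * Real.exp (-M) ≤ 64 * a ^ 3 := by
    have : N * (p * γ ^ 2) * Real.exp (-M) = 64 * (M * Real.exp (-M)) := by rw [hM]; ring
    linarith
  have h4 : 64 * a ^ 3 ≤ δ * (p * γ ^ 2) := by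
    have e : 64 * a ^ 3 = (q * q) * (δ * γ ^ 2) * (64 * q * (γ * δ ^ 2)) := by rw [ha]; ring
    have e1 : γ * δ ^ 2 ≤ 1 := by nlinarith [sq_nonneg δ]
    have e2 : 64 * q * (γ * δ ^ 2) ≤ 64 * q * 1 := by gcongr
    have e3 : (q * q) * (δ * γ ^ 2) ≤ p * (δ * γ ^ 2) := by gcongr
    calc 64 * a ^ 3 = (q * q) * (δ * γ ^ 2) * (64 * q * (γ * δ ^ 2)) := e
      _ ≤ (q * q) * (δ * γ ^ 2) * 1 := by gcongr; linarith
      _ ≤ δ * (p * γ ^ 2) := by linarith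
  have h5 : (N * Real.exp (-M)) * (p * γ ^ 2) ≤ δ * (p * γ ^ 2) := by linarith
  exact le_of_mul_le_mul_right h5 hpg

end SensorGame

end

theorem mainTheorem3 :
    ∃ c₃ c₄ : ℝ, 0 < c₃ ∧ 0 < c₄ ∧
      ∀ (d N : ℕ) (η r δ : ℝ) (w : SensorGame.E d)
        (κ : ProbabilityTheory.Kernel (Fin N → SensorGame.E d) (Fin N → Bool))
        [ProbabilityTheory.IsMarkovKernel κ],
        1 ≤ d → 0 ≤ η → η < 1 / 2 → 0 < δ → δ < 1 → w ≠ 0 →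
        SensorGame.HasNoiseRate w η κ →
        0 < r → r ≤ (1 / 2 - η) / (c₃ * Real.sqrt (d : ℝ)) →
        c₄ / ((r / 2) ^ d * (1 / 2 - η) ^ 2) * Real.log (1 / (r ^ d * (1 / 2 - η) * δ)) ≤ (N : ℝ) →
        ENNReal.ofReal (1 - δ) ≤
          SensorGame.law κ
            {ω | SensorGame.FarSensorsUpdateCorrectly w r ω.1.1 ω.1.2 ω.2} := by
  refine ⟨4096, 384, by norm_num, by norm_num, ?_⟩
  intro d N η r δ w κ _ hd hη0 hη hδ0 hδ hw hκ hr hrd hN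
  have hd' : (1 : ℝ) ≤ √d := by
    rw [Real.one_le_sqrt]; exact_mod_cast hd
  rw [le_div_iff₀ (by positivity)] at hrd
  have hrd' : 4096 * (r * √d) ≤ 1 / 2 - η := by linarith
  have hr1 : r ≤ 1 / 8192 := by nlinarith
  obtain ⟨hN14, hNδ⟩ := SensorGame.exp_tail_le hd hr hr1 (by linarith : 0 < 1 / 2 - η)
    (by linarith) hδ0 hδ hN
  have : MeasureTheory.IsProbabilityMeasure (SensorGame.locationLaw d N) := by
    unfold SensorGame.locationLaw; infer_instance
  have : MeasureTheory.IsProbabilityMeasure (SensorGame.law κ) := by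
    unfold SensorGame.law; infer_instance
  set B : Set (((Fin N → SensorGame.E d) × (Fin N → Bool)) × Equiv.Perm (Fin N)) :=
    ⋃ t : Fin N, {ω | SensorGame.BadMove w r ω.1.1 ω.1.2 ω.2 t} with hB
  have hBδ : SensorGame.law κ B ≤ ENNReal.ofReal δ := by
    refine (MeasureTheory.measure_iUnion_fintype_le _ _).trans ?_
    refine (Finset.sum_le_sum fun t _ => SensorGame.law_badMove_le (by linarith) t fun σ =>
      SensorGame.lintegral_moveWeight_le hd hκ hw hη0 hη hr hrd' hN14 σ t).trans ?_
    rw [Finset.sum_const, Finset.card_univ, Fintype.card_fin, nsmul_eq_mul,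
      ← ENNReal.ofReal_natCast, ← ENNReal.ofReal_mul (Nat.cast_nonneg _)]
    exact ENNReal.ofReal_le_ofReal hNδ
  have hsub : Bᶜ ⊆ {ω | SensorGame.FarSensorsUpdateCorrectly w r ω.1.1 ω.1.2 ω.2} := by
    intro ω hω
    exact SensorGame.farSensorsUpdateCorrectly_of_not_badMove hw hr fun t ht =>
      hω (Set.mem_iUnion.2 ⟨t, ht⟩)
  -- Subadditivity replaces the complement rule, so `B` need not be shown measurable.
  have huniv : 1 ≤ SensorGame.law κ B + SensorGame.law κ Bᶜ := by
    rw [← MeasureTheory.measure_univ (μ := SensorGame.law κ), ← Set.union_compl_self B]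
    exact MeasureTheory.measure_union_le _ _
  calc ENNReal.ofReal (1 - δ) = 1 - ENNReal.ofReal δ := by
        rw [ENNReal.ofReal_sub _ hδ0.le, ENNReal.ofReal_one]
    _ ≤ SensorGame.law κ Bᶜ := by
        rw [tsub_le_iff_left]
        exact huniv.trans (add_le_add_left hBδ _)
    _ ≤ _ := MeasureTheory.measure_mono hsub
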